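/- Logarithms are to base $2$. Let $n\ge 1$ and let $F$ be a discrete distribution over sequences $v=(v_1,\dots,v_n)\in\mathbb{R}_{\ge 0}^n$ (with arbitrary correlations) such that every $v$ in the support has a unique maximal entry; let $F^*$ be the distribution of $\max_i v_i$, $v\sim F$. An online algorithm that knows $F$ observes $k$ independent samples $v^{(1)},\dots,v^{(k)}$ of $F$ (rounds), block after block and, within a block, reward after reward, and may irrevocably accept one reward at its arrival; $\mathrm{ALG}(v)$ is the accepted reward, or $0$ if none is accepted. The $(1-\varepsilon)$-competition complexity of $\mathrm{ALG}$ is the smallest positive integer $k(n,\varepsilon)$ such that $\mathbb{E}_{v\sim F^k}[\mathrm{ALG}(v)]\ge(1-\varepsilon)\,\mathbb{E}_{v\sim F}[\max_i v_i]$ for every such $F$ and every $k\ge k(n,\varepsilon)$ (expectations may be infinite). A $q$-quantile threshold of a distribution $D$ is a real $T$ with $\Pr_D[X<T]\le q\le\Pr_D[X\le T]$. For a prefix $x=(x_1,\dots,x_i)$ let $\mathrm{PM}(x)=\Pr_{v\sim F}[x_i=\max_j v_j\mid v_{\le i}=x]$. Let $0<\varepsilon<1$ be such that $r=\lceil\log\log\frac1\varepsilon+\log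 n\rceil\ge 0$ (automatic if $\varepsilon\le\frac12$). Let $T_0$ be a $(1-\frac1n)$-quantile threshold of $F^*$, let $p=\Pr[\max_j v_j<T_0]$, and for $i\ge 1$ let $T_i$ be a $p^{2^i}$-quantile threshold of $F^*$; such thresholds exist, and any choice is allowed. The two-phase algorithm is the following. Phase 1 ($n+1$ rounds). In each round, upon the arrival of $v_i$, draw independent $Y_i\sim\mathrm{Ber}(\mathrm{PM}(v_{\le i}))$ and $Z_i\sim\mathrm{Ber}\bigl(1/(n-\sum_{j<i}\mathrm{PM}(v_{\le j}))\bigr)$. Call reward $i$ active if $Y_i=1$; it is selected if it is the first reward of the round with $Y_i=Z_i=1$. If the selected reward satisfies $v_i>T_0$, accept it; otherwise accept nothing in this round. Phase 2 ($r+2$ rounds). In its round $t=1,\dots,r+2$, accept the first reward with $v_i\ge T_{\max\{t-2,0\}}$. After phase 2 nothing is accepted. Then the following hold. (1) The selection rule of phase 1 is well defined and is an online contention resolution scheme with selectability exactly $\frac1n$: given the block $v$, reward $i$ is (active and) selected with probability $\frac1n\mathrm{PM}(v_{\le i})$, that is, $\frac1n$ times the probability that it is active. (2) The algorithm uses $n+r+3=n+\lceil\log\log\frac1\varepsilon+\log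 n\rceil+3$ rounds, and for every $k\ge n+r+3$ its value on $k$ copies stochastically dominates $F^*$ up to the $\varepsilon$-quantile: for every real $y$, $\Pr[\mathrm{ALG}(v)\ge y]\ge\Pr[\max_i v_i\ge y]$ or $\Pr[\max_i v_i<y]\le\varepsilon$. More precisely, $\Pr[\max_i v_i<T_r]\le\varepsilon$, and $\Pr[\mathrm{ALG}(v)\ge y]\ge\Pr[\max_i v_i\ge y]$ for every $y\ge T_r$. Its $(1-\varepsilon)$-competition complexity is at most $n+r+3$. (3) Its $(1-\varepsilon)$-competition complexity is at most $(1+o(1))\,(n+\log\log\frac1\varepsilon)$: for every $\delta>0$ there is $M$ such that for all $n\ge1$ and $0<\varepsilon<1$ with $r\ge0$ and $n+\log\log\frac1\varepsilon\ge M$, and for all choices of thresholds, it is at most $n+r+3\le(1+\delta)(n+\log\log\frac1\varepsilon)$. -/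

import Mathlib

open scoped NNReal ENNReal

noncomputable section

namespace CorrProphet

/-! ### Instances -/

/-- A correlated prophet instance with `n` rewards: a discrete distribution over sequences of `n`
nonnegative rewards (arbitrarily correlated), such that in every sequence of the support the
maximum is attained by exactly one reward.  (This forces `1 ≤ n`.) -/
structure Instance (n : ℕ) where
  /-- the joint distribution of the `n` rewards -/
  law : PMF (Fin n → ℝ≥0)
  /-- the maximum of every realization is attained exactly once -/
  unique_max : ∀ v ∈ law.support, ∃! j : Fin n, v j = Finset.univ.sup v

/-- The distribution of the prophet's value `max_i v_i`, `v ∼ F`. -/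
def Instance.maxLaw {n : ℕ} (F : Instance n) : PMF ℝ≥0 :=
  F.law.map fun v => Finset.univ.sup v

/-- The product distribution of `k` independent copies of `F`. -/
def iid {α : Type} (F : PMF α) : (k : ℕ) → PMF (Fin k → α)
  | 0 => PMF.pure Fin.elim0
  | k + 1 => F.bind fun a => (iid F k).map fun v => (Fin.cons a v : Fin (k + 1) → α)

/-! ### Online algorithms in the block arrival model -/

/-- A randomized online algorithm for blocks of `n` rewards.  When reward `i` of round `t` arrives
(rounds and rewards are numbered from `0`), the algorithm sees its internal state, which may
remember anything about the past, and the prefix of the current block up to and including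
reward `i`.  It then randomly either accepts the reward (`none`) or rejects it and moves on to a
new state (`some s`). -/
structure OnlineAlgorithm (n : ℕ) where
  /-- internal states -/
  State : Type
  /-- initial state -/
  init : State
  /-- the randomized decision upon the arrival of a reward -/
  step : (t : ℕ) → (i : Fin n) → (Fin (i.val + 1) → ℝ≥0) → State → PMF (Option State)

namespace OnlineAlgorithm

variable {n : ℕ} (A : OnlineAlgorithm n)

/-- The situation after the first `m` rewards of block `v` in round `t`, when the round is entered
in state `s`: either the index of the accepted reward, or the current state. -/
def runPrefix (t : ℕ) (v : Fin n → ℝ≥0) (s : A.State) :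
    (m : ℕ) → m ≤ n → PMF (Fin n ⊕ A.State)
  | 0, _ => PMF.pure (Sum.inr s)
  | m + 1, h => (runPrefix t v s m (Nat.le_of_succ_le h)).bind fun o =>
      match o with
      | Sum.inl j => PMF.pure (Sum.inl j)
      | Sum.inr s' => (A.step t ⟨m, h⟩ (Fin.take (m + 1) h v) s').map fun d =>
          match d with
          | none => Sum.inl ⟨m, h⟩
          | some s'' => Sum.inr s''

/-- The outcome of the complete round `t` on block `v`, entered in state `s`. -/
def runBlock (t : ℕ) (v : Fin n → ℝ≥0) (s : A.State) : PMF (Fin n ⊕ A.State) :=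
  A.runPrefix t v s n le_rfl

/-- The value obtained from `k` further blocks, the first of which is round `t`, when that round is
entered in state `s`.  If nothing is accepted, the value is `0`. -/
def runFrom : (k : ℕ) → (t : ℕ) → A.State → (Fin k → Fin n → ℝ≥0) → PMF ℝ≥0
  | 0, _, _, _ => PMF.pure 0
  | k + 1, t, s, v => (A.runBlock t (v 0) s).bind fun o =>
      match o with
      | Sum.inl i => PMF.pure (v 0 i)
      | Sum.inr s' => runFrom k (t + 1) s' (Fin.tail v)

/-- The distribution of the value `ALG(v)` when `v` consists of `k` independent copies of `F`. -/
def value (F : Instance n) (k : ℕ) : PMF ℝ≥0 :=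
  (iid F.law k).bind (A.runFrom k 0 A.init)

end OnlineAlgorithm

/-! ### Competition complexity and stochastic domination -/

/-- The expectation of a discrete distribution over nonnegative numbers, possibly infinite. -/
def expect (D : PMF ℝ≥0) : ℝ≥0∞ := ∫⁻ x, (x : ℝ≥0∞) ∂D.toMeasure

/-- The `(1-ε)`-competition complexity of an algorithm (which knows the number of rounds `k` and the
distribution): the least positive integer `K` such that for every instance and every `k ≥ K`
the expected value of the algorithm on `k` independent copies is at least `1-ε` times the expected
maximum of one copy; it is `⊤` if there is no such `K`. -/
def competitionComplexity {n : ℕ} (ALG : ℕ → Instance n → OnlineAlgorithm n) (ε : ℝ) : ℕ∞ :=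
  sInf ((fun K : ℕ => (K : ℕ∞)) '' {K : ℕ | 0 < K ∧ ∀ F : Instance n, ∀ k : ℕ, K ≤ k →
    ENNReal.ofReal (1 - ε) * expect F.maxLaw ≤ expect ((ALG k F).value F k)})

/-- `Pr_{X ∼ D}[X < y]`. -/
def prLT (D : PMF ℝ≥0) (y : ℝ) : ℝ := D.toMeasure.real {x : ℝ≥0 | (x : ℝ) < y}

/-- `Pr_{X ∼ D}[X ≤ y]`. -/
def prLE (D : PMF ℝ≥0) (y : ℝ) : ℝ := D.toMeasure.real {x : ℝ≥0 | (x : ℝ) ≤ y}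

/-- `Pr_{X ∼ D}[X ≥ y]`. -/
def prGE (D : PMF ℝ≥0) (y : ℝ) : ℝ := D.toMeasure.real {x : ℝ≥0 | y ≤ (x : ℝ)}

/-- `T` is a `q`-quantile threshold of `D`. -/
def IsQuantile (D : PMF ℝ≥0) (q T : ℝ) : Prop := prLT D T ≤ q ∧ q ≤ prLE D T

/-- `D₁` stochastically dominates `D₂` up to the `ε`-quantile. -/
def DominatesUpTo (ε : ℝ) (D₁ D₂ : PMF ℝ≥0) : Prop :=
  ∀ y : ℝ, prGE D₂ y ≤ prGE D₁ y ∨ prLT D₂ y ≤ ε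

/-! ### The two-phase algorithm -/

/-- A Bernoulli variable with success probability `p`. -/
def coin (p : ℝ≥0) (h : p ≤ 1) : PMF Bool :=
  PMF.ofFintype (fun b => cond b (p : ℝ≥0∞) (1 - p)) (by
    have h' : (p : ℝ≥0∞) ≤ 1 := by exact_mod_cast h
    simpa using add_tsub_cancel_of_le h')

/-- The probability that, given the prefix `x` of the sequence, the last reward of `x` is the
maximum of the entire sequence. -/
def probMax {n : ℕ} (F : Instance n) {i : ℕ} (hi : i < n) (x : Fin (i + 1) → ℝ≥0) : ℝ≥0 :=
  ((ProbabilityTheory.cond F.law.toMeasure {v | Fin.take (i + 1) hi v = x})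
    {v | x (Fin.last i) = Finset.univ.sup v}).toNNReal

theorem probMax_le_one {n : ℕ} (F : Instance n) {i : ℕ} (hi : i < n) (x : Fin (i + 1) → ℝ≥0) :
    probMax F hi x ≤ 1 := by
  unfold probMax
  have h : (ProbabilityTheory.cond F.law.toMeasure {v | Fin.take (i + 1) hi v = x})
      {v | x (Fin.last i) = Finset.univ.sup v} ≤ 1 := by
    by_cases h0 : F.law.toMeasure {v | Fin.take (i + 1) hi v = x} = 0
    · rw [ProbabilityTheory.cond_eq_zero_of_meas_eq_zero h0]
      simp
    · have := ProbabilityTheory.cond_isProbabilityMeasure (μ := F.law.toMeasure) h0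
      exact MeasureTheory.prob_le_one
  simpa using ENNReal.toNNReal_mono ENNReal.one_ne_top h

/-- The total probability of the rewards strictly before the last one of the prefix `x`,
`∑_{j < i} probMax (x_{≤ j})`. -/
def probMaxBefore {n : ℕ} (F : Instance n) {i : ℕ} (hi : i < n) (x : Fin (i + 1) → ℝ≥0) : ℝ≥0 :=
  ∑ j : Fin i, probMax F (j.isLt.trans hi)
    (Fin.take (j.val + 1) (Nat.succ_le_succ j.isLt.le) x)

theorem probMaxBefore_le {n : ℕ} (F : Instance n) {i : ℕ} (hi : i < n) (x : Fin (i + 1) → ℝ≥0) :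
    probMaxBefore F hi x ≤ i := by
  unfold probMaxBefore
  refine (Finset.sum_le_card_nsmul _ _ 1 fun j _ => probMax_le_one F _ _).trans ?_
  simp

theorem priority_le_one {n : ℕ} (F : Instance n) {i : ℕ} (hi : i < n) (x : Fin (i + 1) → ℝ≥0) :
    1 / ((n : ℝ≥0) - probMaxBefore F hi x) ≤ 1 := by
  have h1 : (1 : ℝ≥0) ≤ (n : ℝ≥0) - probMaxBefore F hi x := by
    refine le_tsub_of_add_le_left ?_
    have h2 : (i : ℝ≥0) + 1 ≤ n := by exact_mod_cast hi
    exact (add_le_add_left (probMaxBefore_le F hi x) 1).trans h2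
  rw [one_div]
  exact inv_le_one_of_one_le₀ h1

/-- One step of the contention resolution scheme.  The state `a` says that no reward of the current
round has been selected yet, and it is reset to `true` at the first reward of the round.  Reward `i`
is active if `Y`, prioritized if `Z`, and it is selected (`none`) if it is active, prioritized, and
nothing was selected before it in this round. -/
def ocrsStep {n : ℕ} (F : Instance n) (i : Fin n) (x : Fin (i.val + 1) → ℝ≥0) (a : Bool) :
    PMF (Option Bool) :=
  let a' : Bool := if i.val = 0 then true else a
  (coin (probMax F i.isLt x) (probMax_le_one F i.isLt x)).bind fun Y =>
    (coin (1 / ((n : ℝ≥0) - probMaxBefore F i.isLt x)) (priority_le_one F i.isLt x)).bind fun Z =>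
      if Y = true ∧ Z = true ∧ a' = true then PMF.pure none else PMF.pure (some a')

/-- The contention resolution scheme alone, as an online selection rule. -/
def ocrs {n : ℕ} (F : Instance n) : OnlineAlgorithm n where
  State := Bool
  init := true
  step := fun _ i x a => ocrsStep F i x a

/-- One step of the first phase: a reward selected by the contention resolution scheme is accepted
if it exceeds the threshold `T₀`; otherwise the rest of the round is skipped. -/
def phaseOneStep {n : ℕ} (F : Instance n) (T₀ : ℝ) (i : Fin n) (x : Fin (i.val + 1) → ℝ≥0)
    (a : Bool) : PMF (Option Bool) :=
  (ocrsStep F i x a).map fun d =>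
    match d with
    | none => if T₀ < (x (Fin.last i.val) : ℝ) then none else some false
    | some a' => some a'

/-- One step of a plain threshold rule. -/
def thresholdStep {i : ℕ} (T : ℝ) (x : Fin (i + 1) → ℝ≥0) (a : Bool) : PMF (Option Bool) :=
  if T ≤ (x (Fin.last i) : ℝ) then PMF.pure none else PMF.pure (some a)

/-- `r = ⌈log log (1/ε) + log n⌉`, with logarithms to base `2`. -/
def rExp (n : ℕ) (ε : ℝ) : ℤ :=
  ⌈Real.logb 2 (Real.logb 2 (1 / ε)) + Real.logb 2 n⌉

/-- The number of rounds of the first phase. -/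
def phaseOneRounds (n : ℕ) : ℕ := n + 1

/-- The number of rounds of the second phase. -/
def phaseTwoRounds (n : ℕ) (ε : ℝ) : ℕ := (rExp n ε + 2).toNat

/-- Admissible thresholds: `T 0` is a `(1-1/n)`-quantile threshold of the distribution of the
maximum and, with `p = Pr[max_j v_j < T 0]`, `T i` is a `p^(2^i)`-quantile threshold of it. -/
structure IsThresholdSeq {n : ℕ} (F : Instance n) (T : ℕ → ℝ) : Prop where
  zero : IsQuantile F.maxLaw (1 - 1 / (n : ℝ)) (T 0)
  pos : ∀ i : ℕ, 1 ≤ i → IsQuantile F.maxLaw (prLT F.maxLaw (T 0) ^ (2 ^ i)) (T i)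

/-- The two-phase algorithm with thresholds `T`.  The first `n + 1` rounds run the contention
resolution scheme with threshold `T 0`; the next `r + 2` rounds use the thresholds
`T 0, T 0, T 1, T 2, …, T r` (subtraction of natural numbers truncates at `0`); afterwards nothing
is accepted. -/
def twoPhase {n : ℕ} (F : Instance n) (T : ℕ → ℝ) (ε : ℝ) : OnlineAlgorithm n where
  State := Bool
  init := true
  step := fun t i x a =>
    if t < phaseOneRounds n then phaseOneStep F (T 0) i x a
    else if t < phaseOneRounds n + phaseTwoRounds n ε then
      thresholdStep (T (t - phaseOneRounds n - 1)) x a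
    else PMF.pure (some a)

end CorrProphet

end

open scoped NNReal ENNReal

noncomputable section

namespace CorrProphet

/-! ### The law of the value, round by round -/

/-! For `y > T 0` phase 1 alone suffices. A reward is reached with the round open with probability
`1 - S/n`, where `S` sums the earlier `probMax`; the priority `1/(n - S)` turns this into selection
with probability exactly `probMax/n` (`runPrefix_phaseOne`). By the tower property and uniqueness of
the maximum, the expected number of active rewards in a set is the probability that the maximum lies
there (`tsum_law_mul_sum_probMax`). Hence, with `q = Pr[max ≥ y]`, each round reached accepts a
reward at least `y` with probability `q/n`, and accepts anything with probability at most `1/n²`.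
Over `n + 1` rounds this gives at least `q/n * (n + 1 - (n + 1)/(2n)) ≥ q`. For `T r ≤ y ≤ T 0`,
phase 1 accepts only values above `y`. Let `T (j+1)` be the first threshold below `y`. A final value
below `y` requires the rounds with thresholds `T 0, T 0, T 1, …, T j` all to accept nothing, which
has probability at most `p * p * p^2 * ⋯ * p^(2^j) = p^(2^(j+1)) ≤ Pr[max ≤ T (j+1)] ≤ Pr[max < y]`.
If no threshold up to `T r` is below `y`, the last round alone suffices. Finally `p ≤ 1 - 1/n ≤ exp
(-1/n)` and `2^r ≥ n log (1/ε)` give `p^(2^r) ≤ ε`. Integrating the tails turns domination above `T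
r` into the bound on expectations. -/

/-- The distribution of the value obtained from `k` further independent blocks, the first of which
is round `t`, when that round is entered in state `s`. -/
def OnlineAlgorithm.valueFrom {n : ℕ} (A : OnlineAlgorithm n) (F : Instance n) (k t : ℕ)
    (s : A.State) : PMF ℝ≥0 :=
  (iid F.law k).bind (A.runFrom k t s)

/-- The present round does not look at later blocks, so their draw can be moved behind its outcome
(`PMF.bind_comm`). All later estimates are inductions along this recursion. -/
theorem OnlineAlgorithm.valueFrom_succ {n : ℕ} (A : OnlineAlgorithm n) (F : Instance n) (k t : ℕ)
    (s : A.State) :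
    A.valueFrom F (k + 1) t s = F.law.bind fun v => (A.runBlock t v s).bind
      (Sum.elim (fun i => PMF.pure (v i)) (fun s' => A.valueFrom F k (t + 1) s')) := by
  unfold valueFrom
  rw [iid, PMF.bind_bind]
  congr 1
  funext v
  rw [PMF.bind_map]
  have h : (A.runFrom (k + 1) t s ∘ fun w => (Fin.cons v w : Fin (k + 1) → Fin n → ℝ≥0)) =
      fun w => (A.runBlock t v s).bind
        (Sum.elim (fun i => PMF.pure (v i)) (fun s' => A.runFrom k (t + 1) s' w)) := by
    funext w
    simp only [Function.comp, runFrom, Fin.cons_zero, Fin.tail_cons]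
    congr 1
    funext o
    cases o <;> rfl
  rw [h, PMF.bind_comm]
  congr 1
  funext o
  cases o <;> simp

theorem OnlineAlgorithm.toOuterMeasure_valueFrom_succ {n : ℕ} (A : OnlineAlgorithm n)
    (F : Instance n) (k t : ℕ) (s : A.State) (S : Set ℝ≥0) :
    (A.valueFrom F (k + 1) t s).toOuterMeasure S =
      ∑' v, F.law v * ∑' o, A.runBlock t v s o *
        Sum.elim (fun i => S.indicator 1 (v i))
          (fun s' => (A.valueFrom F k (t + 1) s').toOuterMeasure S) o := by
  rw [valueFrom_succ, PMF.toOuterMeasure_bind_apply]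
  congr 1
  funext v
  rw [PMF.toOuterMeasure_bind_apply]
  congr 2
  funext o
  cases o with
  | inl i => by_cases h : v i ∈ S <;> simp [PMF.toOuterMeasure_pure_apply, h]
  | inr s' => simp

/-! ### The first phase -/

theorem coin_true (p : ℝ≥0) (h : p ≤ 1) : coin p h true = p := rfl

theorem coin_false (p : ℝ≥0) (h : p ≤ 1) : coin p h false = 1 - p := rfl

/-- The total probability of the first `m` rewards of `v` to be the maximum. -/
def probMaxSum {n : ℕ} (F : Instance n) (v : Fin n → ℝ≥0) (m : ℕ) (h : m ≤ n) : ℝ≥0 :=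
  ∑ j : Fin m, probMax F (j.isLt.trans_le h) (Fin.take (j.val + 1) (j.isLt.trans_le h) v)

theorem probMaxSum_succ {n : ℕ} (F : Instance n) (v : Fin n → ℝ≥0) (m : ℕ) (h : m < n) :
    probMaxSum F v (m + 1) h =
      probMaxSum F v m h.le + probMax F h (Fin.take (m + 1) h v) := by
  unfold probMaxSum
  rw [Fin.sum_univ_castSucc]
  rfl

theorem probMaxBefore_take {n : ℕ} (F : Instance n) (v : Fin n → ℝ≥0) (m : ℕ) (h : m < n) :
    probMaxBefore F h (Fin.take (m + 1) h v) = probMaxSum F v m h.le := rfl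

theorem probMaxSum_le {n : ℕ} (F : Instance n) (v : Fin n → ℝ≥0) (m : ℕ) (h : m ≤ n) :
    probMaxSum F v m h ≤ m := by
  unfold probMaxSum
  refine (Finset.sum_le_card_nsmul _ _ 1 fun j _ => probMax_le_one F _ _).trans ?_
  simp

/-- The probability that a reward is selected, if the round is still open. -/
def selectProb {n : ℕ} (F : Instance n) {i : ℕ} (hi : i < n) (x : Fin (i + 1) → ℝ≥0) : ℝ≥0 :=
  probMax F hi x * (1 / ((n : ℝ≥0) - probMaxBefore F hi x))

/-- The condition `i.val = 0 ∨ a = true` says that the round is open: the first reward resets the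
flag, whatever the entering state. -/
theorem ocrsStep_none {n : ℕ} (F : Instance n) (i : Fin n) (x : Fin (i.val + 1) → ℝ≥0)
    (a : Bool) :
    ocrsStep F i x a none = if i.val = 0 ∨ a = true then (selectProb F i.isLt x : ℝ≥0∞) else 0 := by
  unfold ocrsStep selectProb
  by_cases h : i.val = 0 <;> cases a <;>
    simp [h, PMF.bind_apply, coin_true, coin_false, PMF.pure_apply]

theorem ocrsStep_some_true {n : ℕ} (F : Instance n) (i : Fin n) (x : Fin (i.val + 1) → ℝ≥0)
    (a : Bool) :
    ocrsStep F i x a (some true) =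
      if i.val = 0 ∨ a = true then 1 - (selectProb F i.isLt x : ℝ≥0∞) else 0 := by
  have hsum : ∑ o : Option Bool, ocrsStep F i x a o = 1 := by
    rw [← tsum_fintype (L := .unconditional _)]
    exact PMF.tsum_coe _
  split_ifs with h
  · have h0 : ocrsStep F i x a (some false) = 0 := by
      unfold ocrsStep
      rcases h with h | h <;> simp [h, PMF.bind_apply, PMF.pure_apply]
    rw [Fintype.sum_option, Fintype.sum_bool, h0, add_zero, ocrsStep_none, if_pos h] at hsum
    exact ENNReal.eq_sub_of_add_eq ENNReal.coe_ne_top (by rw [add_comm]; exact hsum)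
  · push Not at h
    unfold ocrsStep
    simp [h.1, h.2, PMF.pure_apply]

theorem phaseOneStep_none {n : ℕ} (F : Instance n) (T : ℝ) (i : Fin n)
    (x : Fin (i.val + 1) → ℝ≥0) (a : Bool) :
    phaseOneStep F T i x a none = if (i.val = 0 ∨ a = true) ∧ T < (x (Fin.last i.val) : ℝ)
      then (selectProb F i.isLt x : ℝ≥0∞) else 0 := by
  unfold phaseOneStep
  rw [PMF.map_apply, tsum_fintype, Fintype.sum_option, Fintype.sum_bool, ocrsStep_none]
  by_cases hT : T < (x (Fin.last i.val) : ℝ) <;> simp [hT]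

theorem phaseOneStep_some_true {n : ℕ} (F : Instance n) (T : ℝ) (i : Fin n)
    (x : Fin (i.val + 1) → ℝ≥0) (a : Bool) :
    phaseOneStep F T i x a (some true) =
      if i.val = 0 ∨ a = true then 1 - (selectProb F i.isLt x : ℝ≥0∞) else 0 := by
  unfold phaseOneStep
  rw [PMF.map_apply, tsum_fintype, Fintype.sum_option, Fintype.sum_bool, ocrsStep_some_true]
  by_cases hT : T < (x (Fin.last i.val) : ℝ) <;> simp [hT]

/-- The reason for the choice of priority: it cancels the probability `1 - S/n` that the round is
still open. Since `S ≤ m < n`, the denominator is nonzero. -/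
theorem one_sub_mul_selectProb {n : ℕ} (F : Instance n) (v : Fin n → ℝ≥0) (m : ℕ) (h : m < n) :
    (1 - probMaxSum F v m h.le / n) * selectProb F h (Fin.take (m + 1) h v) =
      probMax F h (Fin.take (m + 1) h v) / n := by
  have hS : probMaxSum F v m h.le < n :=
    (probMaxSum_le F v m h.le).trans_lt (by exact_mod_cast h)
  have hn : (n : ℝ≥0) ≠ 0 := by exact_mod_cast (Nat.zero_le m).trans_lt h |>.ne'
  have hd : (n : ℝ≥0) - probMaxSum F v m h.le ≠ 0 := (tsub_pos_of_lt hS).ne'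
  unfold selectProb
  rw [probMaxBefore_take]
  have h1 : 1 - probMaxSum F v m h.le / n = ((n : ℝ≥0) - probMaxSum F v m h.le) / n := by
    rw [NNReal.sub_div, div_self hn]
  rw [h1]
  field_simp

theorem OnlineAlgorithm.runPrefix_succ_inl {n : ℕ} (A : OnlineAlgorithm n) [Fintype A.State]
    (t : ℕ) (v : Fin n → ℝ≥0) (s : A.State) (m : ℕ) (h : m + 1 ≤ n) (i : Fin n) :
    A.runPrefix t v s (m + 1) h (Sum.inl i) =
      A.runPrefix t v s m (Nat.le_of_succ_le h) (Sum.inl i) +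
        if i = ⟨m, h⟩ then ∑ a, A.runPrefix t v s m (Nat.le_of_succ_le h) (Sum.inr a) *
          A.step t ⟨m, h⟩ (Fin.take (m + 1) h v) a none else 0 := by
  rw [runPrefix, PMF.bind_apply, tsum_fintype, Fintype.sum_sum_type]
  congr 1
  · simp [PMF.pure_apply]
  · have key : ∀ a, ((A.step t ⟨m, h⟩ (Fin.take (m + 1) h v) a).map fun d =>
        match d with
        | none => (Sum.inl ⟨m, h⟩ : Fin n ⊕ A.State)
        | some s'' => Sum.inr s'') (Sum.inl i) =
        if i = ⟨m, h⟩ then A.step t ⟨m, h⟩ (Fin.take (m + 1) h v) a none else 0 := by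
      intro a
      rw [PMF.map_apply, tsum_fintype, Fintype.sum_option]
      simp
    refine (Finset.sum_congr rfl fun a _ => congrArg _ (key a)).trans ?_
    by_cases hi : i = ⟨m, h⟩ <;> simp [hi]

theorem OnlineAlgorithm.runPrefix_succ_inr {n : ℕ} (A : OnlineAlgorithm n) [Fintype A.State]
    (t : ℕ) (v : Fin n → ℝ≥0) (s : A.State) (m : ℕ) (h : m + 1 ≤ n) (b : A.State) :
    A.runPrefix t v s (m + 1) h (Sum.inr b) =
      ∑ a, A.runPrefix t v s m (Nat.le_of_succ_le h) (Sum.inr a) *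
        A.step t ⟨m, h⟩ (Fin.take (m + 1) h v) a (some b) := by
  rw [runPrefix, PMF.bind_apply, tsum_fintype, Fintype.sum_sum_type]
  have key : ∀ a, ((A.step t ⟨m, h⟩ (Fin.take (m + 1) h v) a).map fun d =>
      match d with
      | none => (Sum.inl ⟨m, h⟩ : Fin n ⊕ A.State)
      | some s'' => Sum.inr s'') (Sum.inr b) =
      A.step t ⟨m, h⟩ (Fin.take (m + 1) h v) a (some b) := by
    intro a
    rw [PMF.map_apply, tsum_eq_single (some b)]
    · simp
    · rintro (_ | c) hc
      · simp
      · exact if_neg fun hbc => hc (congrArg some (Sum.inr.inj hbc).symm)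
  refine (congrArg₂ _ (Finset.sum_eq_zero fun j _ => ?_)
    (Finset.sum_congr rfl fun a _ => congrArg _ (key a))).trans (zero_add _)
  simp [PMF.pure_apply]

/-- The joint law of the accepted reward and of the event that the round is still open, after `m`
rewards of a round that runs the first phase with threshold `T`. -/
theorem runPrefix_phaseOne {n : ℕ} (F : Instance n) (T : ℝ) (init : Bool)
    (step : (t : ℕ) → (i : Fin n) → (Fin (i.val + 1) → ℝ≥0) → Bool → PMF (Option Bool)) (t : ℕ)
    (hstep : ∀ i x a, step t i x a = phaseOneStep F T i x a) (v : Fin n → ℝ≥0) (s : Bool)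
    (m : ℕ) (h : m ≤ n) :
    (∀ i : Fin n, (OnlineAlgorithm.mk Bool init step).runPrefix t v s m h (Sum.inl i) =
      if i.val < m ∧ T < (v i : ℝ) then
        ((probMax F i.isLt (Fin.take (i.val + 1) i.isLt v) / n : ℝ≥0) : ℝ≥0∞) else 0) ∧
    (if m = 0 then 1 else (OnlineAlgorithm.mk Bool init step).runPrefix t v s m h (Sum.inr true)) =
      ((1 - probMaxSum F v m h / n : ℝ≥0) : ℝ≥0∞) := by
  induction m with
  | zero => simp [OnlineAlgorithm.runPrefix, probMaxSum]
  | succ m ih =>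
    obtain ⟨ih1, ih2⟩ := ih (Nat.le_of_succ_le h)
    -- At `m = 0` the state is the entering one and may be `false`, but the step resets it. So the
    -- round counts as open with probability `1` there, whence the `if m = 0` in the induction
    -- hypothesis.
    have hrun : ∀ f : Bool → ℝ≥0∞, ∀ c : ℝ≥0∞,
        (∀ a : Bool, f a = if m = 0 ∨ a = true then c else 0) →
        ∑ a : Bool, (OnlineAlgorithm.mk Bool init step).runPrefix t v s m
          (Nat.le_of_succ_le h) (Sum.inr a) * f a =
          ((1 - probMaxSum F v m (Nat.le_of_succ_le h) / n : ℝ≥0) : ℝ≥0∞) * c := by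
      intro f c hf
      rw [← ih2]
      rcases Nat.eq_zero_or_pos m with rfl | hm
      · cases s <;> simp [OnlineAlgorithm.runPrefix, hf, PMF.pure_apply]
      · simp [hf, hm.ne']
    have hsel := one_sub_mul_selectProb F v m h
    constructor
    · intro i
      let _ : Fintype (OnlineAlgorithm.mk Bool init step).State := Bool.fintype
      rw [OnlineAlgorithm.runPrefix_succ_inl, ih1]
      by_cases hi : i = ⟨m, h⟩
      · subst hi
        rw [if_pos rfl, if_neg (by simp), zero_add]
        by_cases hT : T < (v ⟨m, h⟩ : ℝ)
        · rw [if_pos ⟨Nat.lt_succ_self m, hT⟩, ← hsel, ENNReal.coe_mul]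
          refine hrun _ _ fun a => ?_
          change step t _ _ _ _ = _
          rw [hstep, phaseOneStep_none]
          exact if_congr (and_iff_left hT) rfl rfl
        · rw [if_neg (fun hh => hT hh.2), ← mul_zero]
          refine hrun _ _ fun a => ?_
          change step t _ _ _ _ = _
          rw [hstep, phaseOneStep_none, if_neg (fun hh => hT hh.2), ite_self]
      · have hi' : i.val ≠ m := fun hh => hi (Fin.ext hh)
        rw [if_neg hi, add_zero]
        exact if_congr (and_congr_left' (by omega)) rfl rfl
    · let _ : Fintype (OnlineAlgorithm.mk Bool init step).State := Bool.fintype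
      rw [if_neg (Nat.succ_ne_zero m), OnlineAlgorithm.runPrefix_succ_inr]
      refine (hrun _ (1 - (selectProb F h (Fin.take (m + 1) h v) : ℝ≥0∞)) fun a => ?_).trans ?_
      · change step t _ _ _ _ = _
        rw [hstep, phaseOneStep_some_true]
      · rw [← ENNReal.coe_one, ← ENNReal.coe_sub, ← ENNReal.coe_mul, ENNReal.coe_inj, mul_tsub,
          hsel, mul_one, tsub_tsub, probMaxSum_succ, add_div]

theorem runBlock_phaseOne {n : ℕ} (F : Instance n) (T : ℝ) (init : Bool)
    (step : (t : ℕ) → (i : Fin n) → (Fin (i.val + 1) → ℝ≥0) → Bool → PMF (Option Bool)) (t : ℕ)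
    (hstep : ∀ i x a, step t i x a = phaseOneStep F T i x a) (v : Fin n → ℝ≥0) (s : Bool)
    (i : Fin n) :
    (OnlineAlgorithm.mk Bool init step).runBlock t v s (Sum.inl i) =
      if T < (v i : ℝ) then
        ((probMax F i.isLt (Fin.take (i.val + 1) i.isLt v) / n : ℝ≥0) : ℝ≥0∞) else 0 := by
  rw [OnlineAlgorithm.runBlock, (runPrefix_phaseOne F T init step t hstep v s n le_rfl).1 i]
  exact if_congr (and_iff_right i.isLt) rfl rfl

/-- Rewards are nonnegative, so the threshold `-1` never blocks; the selection scheme thus becomes a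
special case of phase 1. -/
theorem ocrsStep_eq_phaseOneStep {n : ℕ} (F : Instance n) (i : Fin n) (x : Fin (i.val + 1) → ℝ≥0)
    (a : Bool) : ocrsStep F i x a = phaseOneStep F (-1) i x a := by
  have h : (-1 : ℝ) < (x (Fin.last i.val) : ℝ) := by
    linarith [(x (Fin.last i.val)).coe_nonneg]
  unfold phaseOneStep
  conv_lhs => rw [← PMF.map_id (ocrsStep F i x a)]
  congr 1
  funext d
  cases d <;> simp [h]

/-- The contention resolution scheme has selectability `1/n`. -/
theorem runBlock_ocrs {n : ℕ} (F : Instance n) (t : ℕ) (s : Bool) (v : Fin n → ℝ≥0)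
    (i : Fin n) :
    (ocrs F).runBlock t v s (Sum.inl i) =
      (1 / (n : ℝ≥0∞)) * (probMax F i.isLt (Fin.take (i.val + 1) i.isLt v) : ℝ≥0∞) := by
  have hn : (n : ℝ≥0) ≠ 0 := by exact_mod_cast (Nat.zero_le i.val).trans_lt i.isLt |>.ne'
  refine (runBlock_phaseOne F (-1) true (fun _ i x a => ocrsStep F i x a) t
    (fun i x a => ocrsStep_eq_phaseOneStep F i x a) v s i).trans ?_
  rw [if_pos (by linarith [(v i).coe_nonneg]), ENNReal.coe_div hn, ENNReal.coe_natCast,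
    div_eq_mul_inv, mul_comm, one_div]

/-! ### The reward that is active is distributed like the maximum -/

theorem Instance.pos {n : ℕ} (F : Instance n) : 0 < n := by
  obtain ⟨v, hv⟩ := F.law.support_nonempty
  obtain ⟨j, -⟩ := F.unique_max v hv
  exact (Nat.zero_le _).trans_lt j.isLt

/-- Tower property: on the set of blocks with a given prefix `x`, both `probMax` and `v i` are
constant, and multiplying the conditional probability by the mass of that set gives the joint
probability. -/
theorem tsum_law_mul_probMax {n : ℕ} (F : Instance n) (S : Set ℝ≥0) (i : Fin n) :
    ∑' v, F.law v * ((probMax F i.isLt (Fin.take (i.val + 1) i.isLt v) : ℝ≥0∞) *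
      S.indicator 1 (v i)) =
      F.law.toOuterMeasure {v | v i = Finset.univ.sup v ∧ v i ∈ S} := by
  classical
  have hcond : ∀ x : Fin (i.val + 1) → ℝ≥0,
      F.law.toOuterMeasure {v | Fin.take (i.val + 1) i.isLt v = x} * (probMax F i.isLt x : ℝ≥0∞) =
      F.law.toOuterMeasure {v | Fin.take (i.val + 1) i.isLt v = x ∧ v i = Finset.univ.sup v} := by
    intro x
    have hm : MeasurableSet {v : Fin n → ℝ≥0 | Fin.take (i.val + 1) i.isLt v = x} := by
      have : Measurable (fun v : Fin n → ℝ≥0 => Fin.take (i.val + 1) i.isLt v) :=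
        measurable_pi_lambda _ fun j => measurable_pi_apply _
      exact this (measurableSet_singleton x)
    unfold probMax
    rw [ENNReal.coe_toNNReal (MeasureTheory.measure_ne_top _ _),
      ← PMF.toMeasure_apply_eq_toOuterMeasure, ← PMF.toMeasure_apply_eq_toOuterMeasure, mul_comm,
      ProbabilityTheory.cond_mul_eq_inter hm]
    congr 1
    ext v
    simp only [Set.mem_inter_iff, Set.mem_ofPred_eq]
    refine and_congr_right fun hv => ?_
    rw [← hv]
    rfl
  have hsplit : ∀ f : (Fin n → ℝ≥0) → ℝ≥0∞, ∑' v, f v =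
      ∑' x, ∑' v, if Fin.take (i.val + 1) i.isLt v = x then f v else 0 := by
    intro f
    rw [ENNReal.tsum_comm]
    refine tsum_congr fun v => ?_
    rw [tsum_eq_single (Fin.take (i.val + 1) i.isLt v) fun x hx => if_neg hx.symm, if_pos rfl]
  rw [PMF.toOuterMeasure_apply, hsplit, hsplit (Set.indicator _ _)]
  refine tsum_congr fun x => ?_
  have hlast : ∀ v : Fin n → ℝ≥0, Fin.take (i.val + 1) i.isLt v = x → v i = x (Fin.last i.val) := by
    rintro v rfl
    rfl
  calc _ = ∑' v, Set.indicator {v | Fin.take (i.val + 1) i.isLt v = x} F.law v *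
        ((probMax F i.isLt x : ℝ≥0∞) * S.indicator 1 (x (Fin.last i.val))) := by
        refine tsum_congr fun v => ?_
        by_cases hv : Fin.take (i.val + 1) i.isLt v = x
        · simp [hv, hlast v hv]
        · simp [hv]
    _ = ∑' v, Set.indicator {v | Fin.take (i.val + 1) i.isLt v = x ∧ v i = Finset.univ.sup v}
          F.law v * S.indicator 1 (x (Fin.last i.val)) := by
        rw [ENNReal.tsum_mul_right, ENNReal.tsum_mul_right, ← mul_assoc,
          ← PMF.toOuterMeasure_apply, ← PMF.toOuterMeasure_apply, hcond]
    _ = _ := by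
        refine tsum_congr fun v => ?_
        by_cases hv : Fin.take (i.val + 1) i.isLt v = x
        · by_cases hS : x (Fin.last i.val) ∈ S <;>
            by_cases hM : x (Fin.last i.val) = Finset.univ.sup v <;>
            simp [hv, hlast v hv, hS, hM, Set.indicator_apply]
        · simp [hv]

/-- Uniqueness of the maximum enters here: on the support exactly one index attains it, so summing
the events over `i` counts each block once. -/
theorem tsum_law_mul_sum_probMax {n : ℕ} (F : Instance n) (S : Set ℝ≥0) :
    ∑' v, F.law v * ∑ i : Fin n, (probMax F i.isLt (Fin.take (i.val + 1) i.isLt v) : ℝ≥0∞) *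
      S.indicator 1 (v i) = F.maxLaw.toOuterMeasure S := by
  classical
  simp_rw [Finset.mul_sum]
  rw [Summable.tsum_finsetSum fun _ _ => ENNReal.summable]
  simp_rw [tsum_law_mul_probMax, PMF.toOuterMeasure_apply]
  rw [← Summable.tsum_finsetSum fun _ _ => ENNReal.summable, Instance.maxLaw,
    ← PMF.toOuterMeasure_apply, PMF.toOuterMeasure_map_apply, PMF.toOuterMeasure_apply]
  refine tsum_congr fun v => ?_
  by_cases hv : v ∈ F.law.support
  · obtain ⟨j, hj, huniq⟩ := F.unique_max v hv
    rw [Finset.sum_eq_single j]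
    · simp [Set.indicator_apply, hj]
    · intro i _ hij
      exact Set.indicator_of_notMem (fun h => hij (huniq i h.1)) _
    · simp
  · have h0 : F.law v = 0 := by simpa [PMF.mem_support_iff] using hv
    simp [Set.indicator_apply, h0]

/-! ### Elementary facts about the distribution functions -/

theorem prLT_eq (D : PMF ℝ≥0) (y : ℝ) :
    prLT D y = (D.toOuterMeasure {x : ℝ≥0 | (x : ℝ) < y}).toReal := by
  rw [prLT, MeasureTheory.measureReal_def, PMF.toMeasure_apply_eq_toOuterMeasure]

theorem prGE_eq (D : PMF ℝ≥0) (y : ℝ) :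
    prGE D y = (D.toOuterMeasure {x : ℝ≥0 | y ≤ (x : ℝ)}).toReal := by
  rw [prGE, MeasureTheory.measureReal_def, PMF.toMeasure_apply_eq_toOuterMeasure]

theorem toOuterMeasure_ne_top {α : Type*} (D : PMF α) (S : Set α) : D.toOuterMeasure S ≠ ∞ := by
  refine ne_top_of_le_ne_top ENNReal.one_ne_top
    ((D.toOuterMeasure.mono (Set.subset_univ S)).trans_eq ?_)
  exact (D.toOuterMeasure_apply_eq_one_iff _).2 (Set.subset_univ _)

theorem prLT_nonneg (D : PMF ℝ≥0) (y : ℝ) : 0 ≤ prLT D y := MeasureTheory.measureReal_nonneg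

theorem prGE_nonneg (D : PMF ℝ≥0) (y : ℝ) : 0 ≤ prGE D y := MeasureTheory.measureReal_nonneg

theorem prLT_le_one (D : PMF ℝ≥0) (y : ℝ) : prLT D y ≤ 1 := MeasureTheory.measureReal_le_one

theorem prGE_le_one (D : PMF ℝ≥0) (y : ℝ) : prGE D y ≤ 1 := MeasureTheory.measureReal_le_one

theorem prGE_eq_one_sub (D : PMF ℝ≥0) (y : ℝ) : prGE D y = 1 - prLT D y := by
  unfold prGE prLT
  rw [← MeasureTheory.probReal_compl_eq_one_sub (measurableSet_lt (by fun_prop) (by fun_prop))]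
  congr 1
  ext x
  simp

theorem prLT_mono (D : PMF ℝ≥0) {y z : ℝ} (h : y ≤ z) : prLT D y ≤ prLT D z :=
  MeasureTheory.measureReal_mono fun _ hx => lt_of_lt_of_le hx h

theorem prGE_anti (D : PMF ℝ≥0) {y z : ℝ} (h : y ≤ z) : prGE D z ≤ prGE D y :=
  MeasureTheory.measureReal_mono fun _ hx => h.trans hx

theorem prLE_le_prLT (D : PMF ℝ≥0) {y z : ℝ} (h : y < z) : prLE D y ≤ prLT D z :=
  MeasureTheory.measureReal_mono fun _ hx => lt_of_le_of_lt hx h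

theorem toReal_toOuterMeasure_gt (D : PMF ℝ≥0) (y : ℝ) :
    (D.toOuterMeasure {x : ℝ≥0 | y < (x : ℝ)}).toReal = 1 - prLE D y := by
  unfold prLE
  rw [← MeasureTheory.probReal_compl_eq_one_sub (measurableSet_le (by fun_prop) (by fun_prop)),
    ← PMF.toMeasure_apply_eq_toOuterMeasure, ← MeasureTheory.measureReal_def]
  congr 1
  ext x
  simp

theorem tsum_mul_le_of_forall {α : Type*} (D : PMF α) (c : α → ℝ≥0∞) (L : ℝ≥0∞)
    (h : ∀ o, D o ≠ 0 → c o ≤ L) : ∑' o, D o * c o ≤ L := by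
  calc ∑' o, D o * c o ≤ ∑' o, D o * L := by
        refine ENNReal.tsum_le_tsum fun o => ?_
        by_cases ho : D o = 0
        · simp [ho]
        · gcongr
          exact h o ho
    _ = L := by rw [ENNReal.tsum_mul_right, D.tsum_coe, one_mul]

theorem indicator_lt_eq_zero {x : ℝ≥0} {y : ℝ} (h : y ≤ x) :
    Set.indicator {x : ℝ≥0 | (x : ℝ) < y} (1 : ℝ≥0 → ℝ≥0∞) x = 0 := by
  have hx : x ∉ {x : ℝ≥0 | (x : ℝ) < y} := not_lt.2 h
  exact Set.indicator_of_notMem hx _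

/-! ### One round of each phase -/

/-- Only the support of the outcome is needed, since the rule is deterministic. -/
theorem runPrefix_threshold {n : ℕ} (T : ℝ) (init : Bool)
    (step : (t : ℕ) → (i : Fin n) → (Fin (i.val + 1) → ℝ≥0) → Bool → PMF (Option Bool)) (t : ℕ)
    (hstep : ∀ i x a, step t i x a = thresholdStep T x a) (v : Fin n → ℝ≥0) (s : Bool)
    (m : ℕ) (h : m ≤ n) :
    (∀ i : Fin n, (OnlineAlgorithm.mk Bool init step).runPrefix t v s m h (Sum.inl i) ≠ 0 →
      T ≤ (v i : ℝ)) ∧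
    (∀ s' : Bool, (OnlineAlgorithm.mk Bool init step).runPrefix t v s m h (Sum.inr s') ≠ 0 →
      s' = s ∧ ∀ j : Fin n, j.val < m → (v j : ℝ) < T) := by
  induction m with
  | zero => simp [OnlineAlgorithm.runPrefix, PMF.pure_apply]
  | succ m ih =>
    obtain ⟨ih1, ih2⟩ := ih (Nat.le_of_succ_le h)
    let _ : Fintype (OnlineAlgorithm.mk Bool init step).State := Bool.fintype
    have hnone : ∀ a : Bool, step t ⟨m, h⟩ (Fin.take (m + 1) h v) a none ≠ 0 →
        T ≤ (v ⟨m, h⟩ : ℝ) := by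
      intro a ha
      by_contra hT
      refine ha ?_
      rw [hstep, thresholdStep, if_neg (by exact hT)]
      simp
    have hsome : ∀ a b : Bool, step t ⟨m, h⟩ (Fin.take (m + 1) h v) a (some b) ≠ 0 →
        b = a ∧ (v ⟨m, h⟩ : ℝ) < T := by
      intro a b hb
      by_cases hT : T ≤ (v ⟨m, h⟩ : ℝ)
      · refine absurd ?_ hb
        rw [hstep, thresholdStep, if_pos (by exact hT)]
        simp
      · refine ⟨?_, not_le.1 hT⟩
        by_contra hab
        refine hb ?_
        rw [hstep, thresholdStep, if_neg (by exact hT)]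
        simp [PMF.pure_apply, hab]
    constructor
    · intro i hi
      rw [OnlineAlgorithm.runPrefix_succ_inl] at hi
      by_cases h0 : (OnlineAlgorithm.mk Bool init step).runPrefix t v s m
          (Nat.le_of_succ_le h) (Sum.inl i) = 0
      · rw [h0, zero_add] at hi
        by_cases him : i = ⟨m, h⟩
        · rw [if_pos him] at hi
          obtain ⟨a, -, ha⟩ := Finset.exists_ne_zero_of_sum_ne_zero hi
          rw [him]
          exact hnone a (right_ne_zero_of_mul ha)
        · exact absurd (if_neg him) hi
      · exact ih1 i h0
    · intro s' hs'
      rw [OnlineAlgorithm.runPrefix_succ_inr] at hs'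
      obtain ⟨a, -, ha⟩ := Finset.exists_ne_zero_of_sum_ne_zero hs'
      obtain ⟨has, hj⟩ := ih2 a (left_ne_zero_of_mul ha)
      obtain ⟨hsa, hT⟩ := hsome a s' (right_ne_zero_of_mul ha)
      refine ⟨hsa.trans has, fun j hjm => ?_⟩
      rcases Nat.lt_succ_iff_lt_or_eq.1 hjm with hlt | heq
      · exact hj j hlt
      · rwa [show j = ⟨m, h⟩ from Fin.ext heq]

/-- A round with threshold `T ≥ y` leaves a value below `y` only if the maximum of the round is
below `T`. -/
theorem valueFrom_lt_of_threshold {n : ℕ} (F : Instance n) {T y : ℝ} (hy : y ≤ T) (init : Bool)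
    (step : (t : ℕ) → (i : Fin n) → (Fin (i.val + 1) → ℝ≥0) → Bool → PMF (Option Bool)) (t : ℕ)
    (hstep : ∀ i x a, step t i x a = thresholdStep T x a) (k : ℕ) (s : Bool) :
    ((OnlineAlgorithm.mk Bool init step).valueFrom F (k + 1) t s).toOuterMeasure
        {x | (x : ℝ) < y} ≤
      F.maxLaw.toOuterMeasure {x | (x : ℝ) < T} *
        ((OnlineAlgorithm.mk Bool init step).valueFrom F k (t + 1) s).toOuterMeasure
          {x | (x : ℝ) < y} := by
  rw [OnlineAlgorithm.toOuterMeasure_valueFrom_succ, Instance.maxLaw,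
    PMF.toOuterMeasure_map_apply, PMF.toOuterMeasure_apply, ← ENNReal.tsum_mul_right]
  refine ENNReal.tsum_le_tsum fun v => ?_
  obtain ⟨h1, h2⟩ := runPrefix_threshold T init step t hstep v s n le_rfl
  have hn := F.pos
  by_cases hv : ((Finset.univ.sup v : ℝ≥0) : ℝ) < T
  · rw [Set.indicator_of_mem (by exact hv)]
    gcongr
    refine tsum_mul_le_of_forall _ _ _ fun o ho => ?_
    cases o with
    | inl i => exact (indicator_lt_eq_zero (hy.trans (h1 i ho))).trans_le zero_le
    | inr s' =>
      obtain rfl := (h2 s' ho).1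
      exact le_rfl
  · rw [Set.indicator_of_notMem (by exact hv), zero_mul, nonpos_iff_eq_zero, mul_eq_zero]
    right
    rw [← nonpos_iff_eq_zero]
    refine tsum_mul_le_of_forall _ _ _ fun o ho => ?_
    cases o with
    | inl i => exact (indicator_lt_eq_zero (hy.trans (h1 i ho))).le
    | inr s' =>
      refine absurd ?_ hv
      obtain ⟨j, -, hj⟩ := Finset.exists_mem_eq_sup Finset.univ ⟨⟨0, hn⟩, Finset.mem_univ _⟩ v
      rw [hj]
      exact (h2 s' ho).2 j j.isLt

/-- A round of the first phase with threshold `T ≥ y` accepts no reward below `y`. -/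
theorem valueFrom_lt_of_phaseOne {n : ℕ} (F : Instance n) {T y : ℝ} (hy : y ≤ T) (init : Bool)
    (step : (t : ℕ) → (i : Fin n) → (Fin (i.val + 1) → ℝ≥0) → Bool → PMF (Option Bool)) (t : ℕ)
    (hstep : ∀ i x a, step t i x a = phaseOneStep F T i x a) (k : ℕ) (L : ℝ≥0∞)
    (hL : ∀ s : Bool, ((OnlineAlgorithm.mk Bool init step).valueFrom F k (t + 1) s).toOuterMeasure
      {x | (x : ℝ) < y} ≤ L) (s : Bool) :
    ((OnlineAlgorithm.mk Bool init step).valueFrom F (k + 1) t s).toOuterMeasure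
        {x | (x : ℝ) < y} ≤ L := by
  rw [OnlineAlgorithm.toOuterMeasure_valueFrom_succ]
  refine tsum_mul_le_of_forall _ _ _ fun v _ => tsum_mul_le_of_forall _ _ _ fun o ho => ?_
  cases o with
  | inl i =>
    rw [runBlock_phaseOne F T init step t hstep] at ho
    have hT : T < (v i : ℝ) := by
      by_contra hT
      exact ho (if_neg hT)
    exact (indicator_lt_eq_zero (hy.trans hT.le)).trans_le zero_le
  | inr s' => exact hL s'

/-- In a round of the first phase with threshold `T < y`, a reward that is at least `y` is accepted
with probability `Pr[max ≥ y] / n`, and some reward with probability `Pr[max > T] / n`. -/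
theorem le_valueFrom_ge_of_phaseOne {n : ℕ} (F : Instance n) {T y : ℝ} (hy : T < y) (init : Bool)
    (step : (t : ℕ) → (i : Fin n) → (Fin (i.val + 1) → ℝ≥0) → Bool → PMF (Option Bool)) (t : ℕ)
    (hstep : ∀ i x a, step t i x a = phaseOneStep F T i x a) (k : ℕ) (B : ℝ≥0∞)
    (hB : ∀ s : Bool, B ≤ ((OnlineAlgorithm.mk Bool init step).valueFrom F k
      (t + 1) s).toOuterMeasure {x | y ≤ (x : ℝ)}) (s : Bool) :
    F.maxLaw.toOuterMeasure {x | y ≤ (x : ℝ)} * (n : ℝ≥0∞)⁻¹ + B ≤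
      ((OnlineAlgorithm.mk Bool init step).valueFrom F (k + 1) t s).toOuterMeasure
        {x | y ≤ (x : ℝ)} +
      F.maxLaw.toOuterMeasure {x | T < (x : ℝ)} * (n : ℝ≥0∞)⁻¹ * B := by
  have hn : (n : ℝ≥0) ≠ 0 := by exact_mod_cast F.pos.ne'
  let A := OnlineAlgorithm.mk Bool init step
  have hrun : ∀ (v : Fin n → ℝ≥0) (i : Fin n), A.runBlock t v s (Sum.inl i) =
      (probMax F i.isLt (Fin.take (i.val + 1) i.isLt v) : ℝ≥0∞) *
        Set.indicator {x : ℝ≥0 | T < (x : ℝ)} 1 (v i) * (n : ℝ≥0∞)⁻¹ := by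
    intro v i
    rw [runBlock_phaseOne F T init step t hstep, ENNReal.coe_div hn, ENNReal.coe_natCast,
      div_eq_mul_inv]
    by_cases hT : T < (v i : ℝ) <;> simp [hT]
  -- Writing the constant as an average over blocks reduces the claim to an inequality for each
  -- block `v`.
  have hB1 : B = ∑' v, F.law v * B := by rw [ENNReal.tsum_mul_right, F.law.tsum_coe, one_mul]
  rw [OnlineAlgorithm.toOuterMeasure_valueFrom_succ, ← tsum_law_mul_sum_probMax,
    ← tsum_law_mul_sum_probMax, ← ENNReal.tsum_mul_right, ← ENNReal.tsum_mul_right,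
    ← ENNReal.tsum_mul_right]
  nth_rewrite 1 [hB1]
  rw [← ENNReal.tsum_add, ← ENNReal.tsum_add]
  refine ENNReal.tsum_le_tsum fun v => ?_
  have hone : 1 = ∑ i, A.runBlock t v s (Sum.inl i) +
      ∑ b : Bool, A.runBlock t v s (Sum.inr b) := by
    rw [← (A.runBlock t v s).tsum_coe]
    exact (tsum_fintype (fun o : Fin n ⊕ Bool => A.runBlock t v s o)).trans
      (Fintype.sum_sum_type _)
  have hsum : ∑' o, A.runBlock t v s o * Sum.elim
      (fun i => Set.indicator {x : ℝ≥0 | y ≤ (x : ℝ)} 1 (v i))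
      (fun s' => (A.valueFrom F k (t + 1) s').toOuterMeasure {x | y ≤ (x : ℝ)}) o =
      ∑ i, A.runBlock t v s (Sum.inl i) * Set.indicator {x : ℝ≥0 | y ≤ (x : ℝ)} 1 (v i) +
      ∑ b : Bool, A.runBlock t v s (Sum.inr b) *
        (A.valueFrom F k (t + 1) b).toOuterMeasure {x | y ≤ (x : ℝ)} :=
    (tsum_fintype (fun o : Fin n ⊕ Bool => A.runBlock t v s o * Sum.elim
      (fun i => Set.indicator {x : ℝ≥0 | y ≤ (x : ℝ)} 1 (v i))
      (fun s' => (A.valueFrom F k (t + 1) s').toOuterMeasure {x | y ≤ (x : ℝ)}) o)).trans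
      (Fintype.sum_sum_type _)
  have hacc : ∑ i, A.runBlock t v s (Sum.inl i) * Set.indicator {x : ℝ≥0 | y ≤ (x : ℝ)} 1 (v i) =
      (∑ i : Fin n, (probMax F i.isLt (Fin.take (i.val + 1) i.isLt v) : ℝ≥0∞) *
        Set.indicator {x : ℝ≥0 | y ≤ (x : ℝ)} 1 (v i)) * (n : ℝ≥0∞)⁻¹ := by
    rw [Finset.sum_mul]
    refine Finset.sum_congr rfl fun i _ => ?_
    rw [hrun]
    by_cases hi : y ≤ (v i : ℝ)
    · have hT : T < (v i : ℝ) := hy.trans_le hi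
      simp [hi, hT]
    · simp [hi]
  have hsel : ∑ i, A.runBlock t v s (Sum.inl i) =
      (∑ i : Fin n, (probMax F i.isLt (Fin.take (i.val + 1) i.isLt v) : ℝ≥0∞) *
        Set.indicator {x : ℝ≥0 | T < (x : ℝ)} 1 (v i)) * (n : ℝ≥0∞)⁻¹ := by
    rw [Finset.sum_mul]
    exact Finset.sum_congr rfl fun i _ => hrun v i
  have hrest : (∑ b : Bool, A.runBlock t v s (Sum.inr b)) * B ≤ ∑ b : Bool,
      A.runBlock t v s (Sum.inr b) *
        (A.valueFrom F k (t + 1) b).toOuterMeasure {x | y ≤ (x : ℝ)} := by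
    rw [Finset.sum_mul]
    exact Finset.sum_le_sum fun b _ => mul_le_mul_right (hB b) _
  rw [mul_assoc, mul_assoc, mul_assoc, ← mul_add, ← mul_add]
  refine mul_le_mul_right ?_ _
  refine le_of_le_of_eq ?_ (congrArg (· + _) hsum.symm)
  rw [← hacc, ← mul_assoc, ← hsel, add_assoc]
  gcongr
  -- `B` is split by the outcome of the round: the accepting mass becomes the loss term on the
  -- right, the remaining mass continues with at least `B`.
  calc B = (∑ i, A.runBlock t v s (Sum.inl i) + ∑ b : Bool, A.runBlock t v s (Sum.inr b)) * B := by
        rw [← hone, one_mul]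
    _ ≤ _ := by
        rw [add_mul, add_comm]
        gcongr

/-! ### Domination -/

theorem twoPhase_step_one {n : ℕ} (F : Instance n) (T : ℕ → ℝ) (ε : ℝ) {t : ℕ}
    (ht : t < phaseOneRounds n) (i : Fin n) (x : Fin (i.val + 1) → ℝ≥0) (a : Bool) :
    (twoPhase F T ε).step t i x a = phaseOneStep F (T 0) i x a :=
  if_pos ht

theorem twoPhase_step_two {n : ℕ} (F : Instance n) (T : ℕ → ℝ) (ε : ℝ) {u : ℕ}
    (hu : u < phaseTwoRounds n ε) (i : Fin n) (x : Fin (i.val + 1) → ℝ≥0) (a : Bool) :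
    (twoPhase F T ε).step (phaseOneRounds n + u) i x a = thresholdStep (T (u - 1)) x a := by
  refine (if_neg (by omega)).trans ((if_pos (by omega)).trans ?_)
  rw [Nat.add_sub_cancel_left]

theorem prLT_valueFrom_phaseTwo {n : ℕ} (F : Instance n) (T : ℕ → ℝ) (ε y : ℝ) (c : ℕ) :
    ∀ (k u : ℕ) (s : Bool), c ≤ k → u + c ≤ phaseTwoRounds n ε →
      (∀ w, w < u + c → y ≤ T (w - 1)) →
      prLT ((twoPhase F T ε).valueFrom F k (phaseOneRounds n + u) s) y ≤
        ∏ w ∈ Finset.range c, prLT F.maxLaw (T (u + w - 1)) := by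
  induction c with
  | zero => intro k u s _ _ _; simpa using prLT_le_one _ _
  | succ c ih =>
    intro k u s hk hu hy
    obtain ⟨k, rfl⟩ : ∃ k', k = k' + 1 := ⟨k - 1, by omega⟩
    have h := valueFrom_lt_of_threshold F (hy u (by omega)) true (twoPhase F T ε).step
      (phaseOneRounds n + u) (twoPhase_step_two F T ε (by omega)) k s
    have h' := ENNReal.toReal_mono
      (ENNReal.mul_ne_top (toOuterMeasure_ne_top _ _) (toOuterMeasure_ne_top _ _)) h
    rw [ENNReal.toReal_mul, ← prLT_eq, ← prLT_eq, ← prLT_eq] at h'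
    have h2 := ih k (u + 1) s (by omega) (by omega) (fun w hw => hy w (by omega))
    rw [Finset.prod_range_succ', mul_comm]
    refine h'.trans (mul_le_mul_of_nonneg_left (h2.trans_eq ?_) (prLT_nonneg _ _))
    refine Finset.prod_congr rfl fun w _ => ?_
    rw [add_right_comm, add_assoc]

theorem prLT_valueFrom_phaseOne {n : ℕ} (F : Instance n) (T : ℕ → ℝ) (ε : ℝ) {y L : ℝ}
    (hy : y ≤ T 0) (k : ℕ)
    (hL : ∀ s : Bool, prLT ((twoPhase F T ε).valueFrom F k (phaseOneRounds n) s) y ≤ L) (j : ℕ) :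
    ∀ (t : ℕ) (s : Bool), t + j = phaseOneRounds n →
      prLT ((twoPhase F T ε).valueFrom F (k + j) t s) y ≤ L := by
  induction j with
  | zero => rintro t s rfl; exact hL s
  | succ j ih =>
    intro t s ht
    have hL0 : 0 ≤ L := (prLT_nonneg _ _).trans (hL true)
    rw [prLT_eq]
    refine ENNReal.toReal_le_of_le_ofReal hL0 ?_
    refine valueFrom_lt_of_phaseOne F hy true (twoPhase F T ε).step t
      (twoPhase_step_one F T ε (by omega)) (k + j) _ (fun s' => ?_) s
    refine (ENNReal.le_ofReal_iff_toReal_le (toOuterMeasure_ne_top _ _) hL0).2 ?_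
    rw [← prLT_eq]
    exact ih (t + 1) s' (by omega)

/-- Using `T 0` twice (truncated `0 - 1 = 0`) starts the product at `p^2`; each further factor
`p^(2^i)` doubles the exponent. -/
theorem prod_prLT_le {n : ℕ} {F : Instance n} {T : ℕ → ℝ} (hT : IsThresholdSeq F T) (j : ℕ) :
    ∏ w ∈ Finset.range (j + 2), prLT F.maxLaw (T (w - 1)) ≤
      prLT F.maxLaw (T 0) ^ 2 ^ (j + 1) := by
  induction j with
  | zero => simp [Finset.prod_range_succ, pow_two]
  | succ j ih =>
    rw [Finset.prod_range_succ, pow_succ 2 (j + 1), mul_two, pow_add]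
    exact mul_le_mul ih (hT.pos (j + 1) (by omega)).1 (prLT_nonneg _ _)
      (pow_nonneg (prLT_nonneg _ _) _)

theorem prGE_le_value_of_le {n : ℕ} {F : Instance n} {T : ℕ → ℝ} (hT : IsThresholdSeq F T)
    {ε : ℝ} {r : ℕ} (hr : phaseTwoRounds n ε = r + 2) {k : ℕ}
    (hk : phaseOneRounds n + phaseTwoRounds n ε ≤ k) {y : ℝ} (hy0 : y ≤ T 0) (hy : T r ≤ y) :
    prGE F.maxLaw y ≤ prGE ((twoPhase F T ε).value F k) y := by
  rw [prGE_eq_one_sub, prGE_eq_one_sub]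
  refine sub_le_sub_left ?_ 1
  have key : ∀ c, c ≤ r + 2 → (∀ w, w < c → y ≤ T (w - 1)) →
      prLT ((twoPhase F T ε).value F k) y ≤
        ∏ w ∈ Finset.range c, prLT F.maxLaw (T (w - 1)) := by
    intro c hc hw
    have h := prLT_valueFrom_phaseOne F T ε hy0 (k - phaseOneRounds n) (fun s =>
      prLT_valueFrom_phaseTwo F T ε y c (k - phaseOneRounds n) 0 s (by omega) (by omega)
        (fun w hw' => hw w (by omega))) (phaseOneRounds n) 0 true (by omega)
    rw [Nat.sub_add_cancel (by omega)] at h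
    simp only [zero_add] at h
    exact h
  by_cases hall : ∀ i ≤ r, y ≤ T i
  -- All factors but the last, which belongs to `T r ≤ y`, are bounded by `1`.
  · refine (key (r + 2) le_rfl fun w hw => hall _ (by omega)).trans ?_
    rw [Finset.prod_range_succ]
    refine (mul_le_of_le_one_left (prLT_nonneg _ _) (Finset.prod_le_one
      (fun _ _ => prLT_nonneg _ _) fun _ _ => prLT_le_one _ _)).trans ?_
    exact prLT_mono _ hy
  · have hex : ∃ i, T i < y := by
      push Not at hall
      obtain ⟨i, -, hi⟩ := hall
      exact ⟨i, hi⟩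
    classical
    have hle : Nat.find hex ≤ r := by
      push Not at hall
      obtain ⟨i, hir, hi⟩ := hall
      exact (Nat.find_min' hex hi).trans hir
    obtain ⟨j, hj⟩ : ∃ j, Nat.find hex = j + 1 := by
      refine Nat.exists_eq_succ_of_ne_zero fun h0 => ?_
      exact absurd (h0 ▸ Nat.find_spec hex) (not_lt.2 hy0)
    have hlt : T (j + 1) < y := hj ▸ Nat.find_spec hex
    -- By minimality of `j + 1`, the first `j + 2` rounds of phase 2 have thresholds at least `y`.
    refine (key (j + 2) (by omega) fun w hw =>
      not_lt.1 (Nat.find_min hex (m := w - 1) (by omega))).trans ?_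
    exact (prod_prLT_le hT j).trans
      ((hT.pos (j + 1) (by omega)).2.trans (prLE_le_prLT _ hlt))

/-- The bound is `q/n * ∑_{i<j} (1 - i/n²)`: an additional round gains `q/n` and loses at most
`1/n²` of the probability `B ≤ q/n * j` from the rounds after it. -/
theorem prGE_valueFrom_phaseOne {n : ℕ} {F : Instance n} {T : ℕ → ℝ} (hT : IsThresholdSeq F T)
    (ε : ℝ) {y : ℝ} (hy : T 0 < y) (k j : ℕ) :
    ∀ (t : ℕ) (s : Bool), t + j = phaseOneRounds n →
      prGE F.maxLaw y / n * (j - j * (j - 1) / (2 * n ^ 2)) ≤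
        prGE ((twoPhase F T ε).valueFrom F (k + j) t s) y := by
  induction j with
  | zero => intro t s _; simpa using prGE_nonneg _ _
  | succ j ih =>
    intro t s ht
    have hn1 : 1 ≤ n := F.pos
    have hn : (1 : ℝ) ≤ n := by exact_mod_cast hn1
    have hjn : (j : ℝ) ≤ n := by
      have : j ≤ n := by unfold phaseOneRounds at ht; omega
      exact_mod_cast this
    set q := prGE F.maxLaw y with hq
    have hq0 : 0 ≤ q := prGE_nonneg _ _
    set B : ℝ := q / n * (j - j * (j - 1) / (2 * n ^ 2)) with hB
    have hBj : B ≤ q / n * j := by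
      refine mul_le_mul_of_nonneg_left ?_ (by positivity)
      have : 0 ≤ (j : ℝ) * (j - 1) := by
        rcases Nat.eq_zero_or_pos j with rfl | hj
        · simp
        · have : (1 : ℝ) ≤ j := by exact_mod_cast hj
          exact mul_nonneg (by positivity) (by linarith)
      have : 0 ≤ (j : ℝ) * (j - 1) / (2 * n ^ 2) := by positivity
      linarith
    have hB0 : 0 ≤ B := by
      refine mul_nonneg (by positivity) ?_
      rw [sub_nonneg, div_le_iff₀ (by positivity)]
      have : (j : ℝ) - 1 ≤ 2 * n ^ 2 := by nlinarith
      exact mul_le_mul_of_nonneg_left this (by positivity)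
    have h := le_valueFrom_ge_of_phaseOne F hy true (twoPhase F T ε).step t
      (twoPhase_step_one F T ε (by omega)) (k + j) (ENNReal.ofReal B) (fun s' => by
        refine ENNReal.ofReal_le_of_le_toReal ?_
        rw [← prGE_eq]
        exact ih (t + 1) s' (by omega)) s
    have hinv : (n : ℝ≥0∞)⁻¹ ≠ ∞ := by simpa using F.pos.ne'
    have hne := toOuterMeasure_ne_top F.maxLaw
    have h' := ENNReal.toReal_mono (ENNReal.add_ne_top.2 ⟨toOuterMeasure_ne_top _ _,
      ENNReal.mul_ne_top (ENNReal.mul_ne_top (hne _) hinv) ENNReal.ofReal_ne_top⟩) h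
    rw [ENNReal.toReal_add (ENNReal.mul_ne_top (hne _) hinv) ENNReal.ofReal_ne_top,
      ENNReal.toReal_add (toOuterMeasure_ne_top _ _)
        (ENNReal.mul_ne_top (ENNReal.mul_ne_top (hne _) hinv) ENNReal.ofReal_ne_top),
      ENNReal.toReal_mul, ENNReal.toReal_mul, ENNReal.toReal_mul, ENNReal.toReal_ofReal hB0,
      ENNReal.toReal_inv, ENNReal.toReal_natCast, toReal_toOuterMeasure_gt, ← prGE_eq, ← prGE_eq,
      ← hq] at h'
    have hquant : 1 - prLE F.maxLaw (T 0) ≤ 1 / n := by linarith [hT.zero.2]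
    have h3 : (1 - prLE F.maxLaw (T 0)) * (n : ℝ)⁻¹ * B ≤ 1 / n * (n : ℝ)⁻¹ * (q / n * j) := by
      gcongr
    refine le_trans ?_ (sub_le_iff_le_add.2 (h'.trans (add_le_add_right h3 _)))
    rw [hB]
    apply le_of_eq
    push_cast
    field_simp
    ring

theorem prGE_le_value_of_lt {n : ℕ} {F : Instance n} {T : ℕ → ℝ} (hT : IsThresholdSeq F T)
    (ε : ℝ) {k : ℕ} (hk : phaseOneRounds n ≤ k) {y : ℝ} (hy : T 0 < y) :
    prGE F.maxLaw y ≤ prGE ((twoPhase F T ε).value F k) y := by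
  have h := prGE_valueFrom_phaseOne hT ε hy (k - phaseOneRounds n) (phaseOneRounds n) 0 true
    (by omega)
  rw [Nat.sub_add_cancel hk] at h
  refine le_trans ?_ h
  have hn1 : 1 ≤ n := F.pos
  have hn : (1 : ℝ) ≤ n := by exact_mod_cast hn1
  have hq0 := prGE_nonneg F.maxLaw y
  -- With `n + 1` rounds the total loss is `(n + 1)/(2n) ≤ 1`, which the one round beyond `n` pays
  -- for.
  have h1 : (n : ℝ) ≤ ((phaseOneRounds n : ℕ) : ℝ) - ((phaseOneRounds n : ℕ) : ℝ) *
      (((phaseOneRounds n : ℕ) : ℝ) - 1) / (2 * n ^ 2) := by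
    unfold phaseOneRounds
    push_cast
    have : ((n : ℝ) + 1) * (n + 1 - 1) / (2 * n ^ 2) ≤ 1 := by
      rw [div_le_one (by positivity)]
      nlinarith
    linarith
  calc prGE F.maxLaw y = prGE F.maxLaw y / n * n := by field_simp
    _ ≤ _ := mul_le_mul_of_nonneg_left h1 (by positivity)

/-- The value of the two-phase algorithm dominates the maximum down to the last threshold. -/
theorem prGE_le_value {n : ℕ} {F : Instance n} {T : ℕ → ℝ} (hT : IsThresholdSeq F T)
    {ε : ℝ} {r : ℕ} (hr : phaseTwoRounds n ε = r + 2) {k : ℕ}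
    (hk : phaseOneRounds n + phaseTwoRounds n ε ≤ k) {y : ℝ} (hy : T r ≤ y) :
    prGE F.maxLaw y ≤ prGE ((twoPhase F T ε).value F k) y := by
  rcases le_or_gt y (T 0) with h | h
  · exact prGE_le_value_of_le hT hr hk h hy
  · exact prGE_le_value_of_lt hT ε (by omega) h

/-! ### Thresholds -/

/-- The supremum of the `t` with `Pr[X < t] ≤ q` works, by continuity of the measure from below and
from above; `q < 1` bounds this set. -/
theorem exists_isQuantile (D : PMF ℝ≥0) {q : ℝ} (h0 : 0 ≤ q) (h1 : q < 1) :
    ∃ T, IsQuantile D q T := by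
  have hlim : Filter.Tendsto (fun m : ℕ => prLT D m) Filter.atTop (nhds 1) := by
    have h := MeasureTheory.tendsto_measure_iUnion_atTop (μ := D.toMeasure)
      (s := fun m : ℕ => {x : ℝ≥0 | (x : ℝ) < m}) (fun a b hab x hx => by
        have : (a : ℝ) ≤ b := by exact_mod_cast hab
        exact lt_of_lt_of_le hx this)
    have hU : (⋃ m : ℕ, {x : ℝ≥0 | (x : ℝ) < m}) = Set.univ := by
      ext x
      simpa using exists_nat_gt (x : ℝ)
    rw [hU, MeasureTheory.measure_univ] at h
    exact (ENNReal.tendsto_toReal ENNReal.one_ne_top).comp h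
  obtain ⟨b, hb⟩ := (hlim.eventually (lt_mem_nhds h1)).exists
  set A : Set ℝ := {t | prLT D t ≤ q} with hA
  have hne : A.Nonempty := by
    refine ⟨0, ?_⟩
    have : {x : ℝ≥0 | (x : ℝ) < 0} = ∅ := by
      ext x
      simp
    simpa [hA, prLT, this] using h0
  have hbdd : BddAbove A := by
    refine ⟨b, fun t ht => ?_⟩
    by_contra hlt
    exact absurd (hb.trans_le (prLT_mono D (not_le.1 hlt).le)) (not_lt.2 ht)
  refine ⟨sSup A, ?_, ?_⟩
  · have h := MeasureTheory.tendsto_measure_iUnion_atTop (μ := D.toMeasure)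
      (s := fun m : ℕ => {x : ℝ≥0 | (x : ℝ) < sSup A - 1 / ((m : ℝ) + 1)}) (fun a b hab x hx => by
        have : sSup A - 1 / ((a : ℝ) + 1) ≤ sSup A - 1 / ((b : ℝ) + 1) := by
          gcongr
        exact lt_of_lt_of_le hx this)
    have hU : (⋃ m : ℕ, {x : ℝ≥0 | (x : ℝ) < sSup A - 1 / ((m : ℝ) + 1)}) =
        {x : ℝ≥0 | (x : ℝ) < sSup A} := by
      ext x
      simp only [Set.mem_iUnion, Set.mem_ofPred_eq]
      constructor
      · rintro ⟨m, hm⟩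
        have : 0 < 1 / ((m : ℝ) + 1) := by positivity
        linarith
      · intro hx
        obtain ⟨m, hm⟩ := exists_nat_one_div_lt (sub_pos.2 hx)
        exact ⟨m, by linarith⟩
    rw [hU] at h
    refine le_of_tendsto ((ENNReal.tendsto_toReal (MeasureTheory.measure_ne_top _ _)).comp h)
      (Filter.Eventually.of_forall fun m => ?_)
    have hpos : 0 < 1 / ((m : ℝ) + 1) := by positivity
    obtain ⟨t, ht, hlt⟩ := exists_lt_of_lt_csSup hne (sub_lt_self (sSup A) hpos)
    exact (prLT_mono D hlt.le).trans ht
  · have h := MeasureTheory.tendsto_measure_iInter_atTop (μ := D.toMeasure)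
      (s := fun m : ℕ => {x : ℝ≥0 | (x : ℝ) < sSup A + 1 / ((m : ℝ) + 1)})
      (fun m => (measurableSet_lt (by fun_prop) (by fun_prop)).nullMeasurableSet)
      (fun a b hab x hx => by
        have : sSup A + 1 / ((b : ℝ) + 1) ≤ sSup A + 1 / ((a : ℝ) + 1) := by
          gcongr
        exact lt_of_lt_of_le hx this) ⟨0, MeasureTheory.measure_ne_top _ _⟩
    have hI : (⋂ m : ℕ, {x : ℝ≥0 | (x : ℝ) < sSup A + 1 / ((m : ℝ) + 1)}) =
        {x : ℝ≥0 | (x : ℝ) ≤ sSup A} := by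
      ext x
      simp only [Set.mem_iInter, Set.mem_ofPred_eq]
      constructor
      · intro hx
        by_contra hlt
        obtain ⟨m, hm⟩ := exists_nat_one_div_lt (sub_pos.2 (not_le.1 hlt))
        linarith [hx m]
      · intro hx m
        have : 0 < 1 / ((m : ℝ) + 1) := by positivity
        linarith
    rw [hI] at h
    refine ge_of_tendsto ((ENNReal.tendsto_toReal (MeasureTheory.measure_ne_top _ _)).comp h)
      (Filter.Eventually.of_forall fun m => ?_)
    have hpos : 0 < 1 / ((m : ℝ) + 1) := by positivity
    by_contra hlt
    exact absurd (le_csSup hbdd (show sSup A + 1 / ((m : ℝ) + 1) ∈ A from (not_le.1 hlt).le))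
      (by linarith)

theorem exists_isThresholdSeq {n : ℕ} (F : Instance n) : ∃ T : ℕ → ℝ, IsThresholdSeq F T := by
  have hn : (1 : ℝ) ≤ n := by exact_mod_cast F.pos
  obtain ⟨T₀, hT₀⟩ := exists_isQuantile F.maxLaw (q := 1 - 1 / (n : ℝ))
    (by rw [sub_nonneg, div_le_one (by positivity)]; exact hn)
    (by have : 0 < 1 / (n : ℝ) := by positivity
        linarith)
  have hp : prLT F.maxLaw T₀ < 1 := hT₀.1.trans_lt (by
    have : 0 < 1 / (n : ℝ) := by positivity
    linarith)
  choose T hT using fun i : ℕ => exists_isQuantile F.maxLaw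
    (pow_nonneg (prLT_nonneg F.maxLaw T₀) (2 ^ i))
    (pow_lt_one₀ (prLT_nonneg F.maxLaw T₀) hp (by positivity))
  refine ⟨fun i => if i = 0 then T₀ else T i, by simpa using hT₀, fun i hi => ?_⟩
  have : i ≠ 0 := by omega
  simpa [this] using hT i

/-- The last threshold is at most the `ε`-quantile. -/
theorem prLT_last_le {n : ℕ} {F : Instance n} {T : ℕ → ℝ} (hT : IsThresholdSeq F T) {ε : ℝ}
    (h0 : 0 < ε) (h1 : ε < 1) {r : ℕ} (hr : rExp n ε ≤ r) : prLT F.maxLaw (T r) ≤ ε := by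
  have hn : (1 : ℝ) ≤ n := by exact_mod_cast F.pos
  have hlog : 0 < Real.logb 2 (1 / ε) :=
    Real.logb_pos one_lt_two (by rw [one_div]; exact (one_lt_inv₀ h0).2 h1)
  have hpow : Real.logb 2 (1 / ε) * n ≤ 2 ^ r := by
    have h : Real.logb 2 (Real.logb 2 (1 / ε)) + Real.logb 2 n ≤ (r : ℝ) := by
      refine (Int.le_ceil _).trans ?_
      exact_mod_cast hr
    rw [← Real.logb_mul hlog.ne' (by positivity), Real.logb_le_iff_le_rpow one_lt_two
      (by positivity)] at h
    simpa using h
  -- For `r = 0` the exponent is `1` and the bound is trivial; the quantile property of `T r` covers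
  -- only `r ≥ 1`.
  have hr' : prLT F.maxLaw (T r) ≤ prLT F.maxLaw (T 0) ^ 2 ^ r := by
    rcases Nat.eq_zero_or_pos r with rfl | hr0
    · simp
    · exact (hT.pos r hr0).1
  have hexp : prLT F.maxLaw (T 0) ≤ Real.exp (-(1 / n)) :=
    hT.zero.1.trans (by linarith [Real.add_one_le_exp (-(1 / (n : ℝ)))])
  have hln2 : 0 < Real.log 2 := Real.log_pos one_lt_two
  have hln2' : Real.log 2 ≤ 1 := by linarith [Real.log_two_lt_d9]
  refine hr'.trans ((pow_le_pow_left₀ (prLT_nonneg _ _) hexp _).trans ?_)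
  rw [← Real.exp_nat_mul, ← Real.le_log_iff_exp_le h0]
  push_cast
  have h2 : Real.logb 2 (1 / ε) ≤ 2 ^ r * (1 / n) := by
    rw [mul_one_div, le_div_iff₀ (by positivity)]
    exact hpow
  -- As `log 2 ≤ 1`, passing from base `2` to base `e` goes in the favourable direction.
  have h3 : Real.log (1 / ε) ≤ Real.logb 2 (1 / ε) := by
    rw [Real.logb, le_div_iff₀ hln2]
    exact mul_le_of_le_one_right
      (Real.log_nonneg (by rw [one_div]; exact (one_lt_inv₀ h0).2 h1 |>.le)) hln2'
  rw [one_div, Real.log_inv] at h3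
  rw [one_div] at h2
  linarith

/-! ### Expectations and competition complexity -/

theorem expect_eq_lintegral (D : PMF ℝ≥0) :
    expect D = ∫⁻ y in Set.Ioi (0 : ℝ), ENNReal.ofReal (prGE D y) := by
  have h := MeasureTheory.lintegral_eq_lintegral_meas_le D.toMeasure (f := fun x : ℝ≥0 => (x : ℝ))
    (Filter.Eventually.of_forall fun x => x.coe_nonneg) (by fun_prop)
  simp only [ENNReal.ofReal_coe_nnreal] at h
  rw [expect, h]
  refine MeasureTheory.lintegral_congr fun y => ?_
  rw [prGE, MeasureTheory.ofReal_measureReal]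

theorem mul_expect_le {ε : ℝ} (h1 : ε < 1) (D E : PMF ℝ≥0)
    (h : ∀ y, (1 - ε) * prGE E y ≤ prGE D y) :
    ENNReal.ofReal (1 - ε) * expect E ≤ expect D := by
  rw [expect_eq_lintegral, expect_eq_lintegral,
    ← MeasureTheory.lintegral_const_mul' _ _ ENNReal.ofReal_ne_top]
  refine MeasureTheory.lintegral_mono fun y => ?_
  rw [← ENNReal.ofReal_mul (by linarith)]
  exact ENNReal.ofReal_le_ofReal (h y)

theorem competitionComplexity_twoPhase_le {n : ℕ} {ε : ℝ} (h0 : 0 < ε) (h1 : ε < 1)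
    (hr : 0 ≤ rExp n ε) {τ : Instance n → ℕ → ℝ} (hτ : ∀ F, IsThresholdSeq F (τ F)) :
    competitionComplexity (fun _ F => twoPhase F (τ F) ε) ε
      ≤ ((phaseOneRounds n + phaseTwoRounds n ε : ℕ) : ℕ∞) := by
  refine sInf_le ⟨_, ⟨by unfold phaseOneRounds; omega, fun F k hk => ?_⟩, rfl⟩
  have hr2 : phaseTwoRounds n ε = (rExp n ε).toNat + 2 := by unfold phaseTwoRounds; omega
  have hlast := prLT_last_le (hτ F) h0 h1 (r := (rExp n ε).toNat) (by omega)
  refine mul_expect_le h1 _ _ fun y => ?_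
  rcases le_total (τ F (rExp n ε).toNat) y with hy | hy
  · exact (mul_le_of_le_one_left (prGE_nonneg _ _) (by linarith)).trans
      (prGE_le_value (hτ F) hr2 hk hy)
  -- Below the last threshold, `Pr[ALG ≥ y] ≥ Pr[ALG ≥ T r] ≥ Pr[max ≥ T r] ≥ 1 - ε`.
  · refine (mul_le_of_le_one_right (by linarith) (prGE_le_one _ _)).trans
      (le_trans ?_ ((prGE_le_value (hτ F) hr2 hk le_rfl).trans (prGE_anti _ hy)))
    rw [prGE_eq_one_sub]
    linarith

/-! ### Asymptotics of the number of rounds -/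

theorem exists_logb_two_le {c : ℝ} (hc : 0 < c) :
    ∃ C : ℝ, ∀ n : ℕ, 1 ≤ n → Real.logb 2 n ≤ c * n + C := by
  have hln2 : 0 < Real.log 2 := Real.log_pos one_lt_two
  -- The constant comes from `log x ≤ x - 1` at `x = c * log 2 * n`.
  refine ⟨-Real.log (c * Real.log 2) / Real.log 2, fun n hn => ?_⟩
  have hn' : (0 : ℝ) < n := by exact_mod_cast hn
  have h := Real.log_le_sub_one_of_pos (show 0 < c * Real.log 2 * n by positivity)
  rw [Real.log_mul (by positivity) hn'.ne'] at h
  rw [Real.logb, div_le_iff₀ hln2, add_mul, div_mul_cancel₀ _ hln2.ne']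
  nlinarith

theorem exists_rounds_le {δ : ℝ} (hδ : 0 < δ) : ∃ M : ℝ, ∀ (n : ℕ) (ε : ℝ), 1 ≤ n →
    0 ≤ rExp n ε → M ≤ n + Real.logb 2 (Real.logb 2 (1 / ε)) →
    (n : ℝ) + rExp n ε + 3 ≤ (1 + δ) * (n + Real.logb 2 (Real.logb 2 (1 / ε))) := by
  obtain ⟨C₁, hC₁⟩ := exists_logb_two_le (c := 1 / 2) (by norm_num)
  obtain ⟨C₂, hC₂⟩ := exists_logb_two_le (c := δ / 4) (by positivity)
  -- `M` is chosen so that `δ/2 * M` absorbs all constants; the `4` is the `3` extra rounds plus `1`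
  -- for the ceiling.
  refine ⟨2 / δ * (δ / 4 * (2 * (1 + C₁)) + C₂ + 4), fun n ε hn hr hM => ?_⟩
  set L := Real.logb 2 (Real.logb 2 (1 / ε)) with hL
  have h1 := hC₁ n hn
  have h2 := hC₂ n hn
  have hlt : (rExp n ε : ℝ) < L + Real.logb 2 n + 1 := Int.ceil_lt_add_one _
  have hr' : (0 : ℝ) ≤ rExp n ε := by exact_mod_cast hr
  -- `L` may be negative, but `r ≥ 0` forces `L > -logb 2 n - 1`, so `n` is at most about twice `n +
  -- L`.
  have h3 : (n : ℝ) ≤ 2 * (n + L) + 2 * (1 + C₁) := by linarith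
  have h4 : δ / 4 * n ≤ δ / 4 * (2 * (n + L) + 2 * (1 + C₁)) := by gcongr
  have h5 : δ / 4 * (2 * (1 + C₁)) + C₂ + 4 ≤ δ / 2 * (n + L) := by
    have := mul_le_mul_of_nonneg_left hM (show 0 ≤ δ / 2 by positivity)
    refine le_trans (le_of_eq ?_) this
    field_simp
  linarith

end CorrProphet

end

open CorrProphet in
theorem theorem1 :
    -- the algorithm is well defined, and its contention resolution scheme has selectability `1/n`
    (∀ (n : ℕ) (F : Instance n),
      (∃ T : ℕ → ℝ, IsThresholdSeq F T) ∧
      ∀ (t : ℕ) (s : (ocrs F).State) (v : Fin n → NNReal) (i : Fin n),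
        (ocrs F).runBlock t v s (Sum.inl i) =
          (1 / (n : ENNReal)) * (probMax F i.isLt (Fin.take (i.val + 1) i.isLt v) : ENNReal)) ∧
    -- it uses `n + r + 3` rounds, its value dominates the maximum down to `T r`, which is at most
    -- the `ε`-quantile, and its competition complexity is at most `n + r + 3`
    (∀ (n : ℕ) (ε : ℝ), 1 ≤ n → 0 < ε → ε < 1 → 0 ≤ rExp n ε →
      ((phaseOneRounds n + phaseTwoRounds n ε : ℕ) : ℤ) = n + rExp n ε + 3 ∧
      ∀ τ : Instance n → ℕ → ℝ, (∀ F, IsThresholdSeq F (τ F)) →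
        (∀ (F : Instance n) (k : ℕ), phaseOneRounds n + phaseTwoRounds n ε ≤ k →
          DominatesUpTo ε ((twoPhase F (τ F) ε).value F k) F.maxLaw ∧
          prLT F.maxLaw (τ F (rExp n ε).toNat) ≤ ε ∧
          ∀ y : ℝ, τ F (rExp n ε).toNat ≤ y →
            prGE F.maxLaw y ≤ prGE ((twoPhase F (τ F) ε).value F k) y) ∧
        competitionComplexity (fun _ F => twoPhase F (τ F) ε) ε
          ≤ ((phaseOneRounds n + phaseTwoRounds n ε : ℕ) : ℕ∞)) ∧
    -- the competition complexity is `(1 + o(1)) (n + log log (1/ε))`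
    (∀ δ : ℝ, 0 < δ → ∃ M : ℝ, ∀ (n : ℕ) (ε : ℝ), 1 ≤ n → 0 < ε → ε < 1 → 0 ≤ rExp n ε →
      M ≤ n + Real.logb 2 (Real.logb 2 (1 / ε)) →
      ∀ τ : Instance n → ℕ → ℝ, (∀ F, IsThresholdSeq F (τ F)) →
        ∃ K : ℕ, competitionComplexity (fun _ F => twoPhase F (τ F) ε) ε = (K : ℕ∞) ∧
          K ≤ phaseOneRounds n + phaseTwoRounds n ε ∧
          ((phaseOneRounds n + phaseTwoRounds n ε : ℕ) : ℝ) ≤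
            (1 + δ) * (n + Real.logb 2 (Real.logb 2 (1 / ε)))) := by
  have hrounds : ∀ (n : ℕ) (ε : ℝ), 0 ≤ rExp n ε →
      ((phaseOneRounds n + phaseTwoRounds n ε : ℕ) : ℤ) = n + rExp n ε + 3 := by
    intro n ε hr
    unfold phaseOneRounds phaseTwoRounds
    omega
  refine ⟨fun n F => ⟨exists_isThresholdSeq F, fun t s v i => runBlock_ocrs F t s v i⟩, ?_, ?_⟩
  · intro n ε _ h0 h1 hr
    refine ⟨hrounds n ε hr, fun τ hτ =>
      ⟨fun F k hk => ?_, competitionComplexity_twoPhase_le h0 h1 hr hτ⟩⟩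
    have hlast := prLT_last_le (hτ F) h0 h1 (r := (rExp n ε).toNat) (by omega)
    have hdom : ∀ y : ℝ, τ F (rExp n ε).toNat ≤ y →
        prGE F.maxLaw y ≤ prGE ((twoPhase F (τ F) ε).value F k) y := fun y hy =>
      prGE_le_value (hτ F) (by unfold phaseTwoRounds; omega) hk hy
    refine ⟨fun y => ?_, hlast, hdom⟩
    rcases le_total (τ F (rExp n ε).toNat) y with hy | hy
    · exact Or.inl (hdom y hy)
    · exact Or.inr ((prLT_mono _ hy).trans hlast)
  · intro δ hδ
    obtain ⟨M, hM⟩ := exists_rounds_le hδ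
    refine ⟨M, fun n ε hn h0 h1 hr hMn τ hτ => ?_⟩
    have hle := competitionComplexity_twoPhase_le h0 h1 hr hτ
    -- The upper bound excludes `⊤`, so the complexity is a genuine natural number.
    obtain ⟨K, hK⟩ := ENat.ne_top_iff_exists.1 (ne_top_of_le_ne_top (ENat.natCast_ne_top _) hle)
    refine ⟨K, hK.symm, ?_, ?_⟩
    · rw [← hK] at hle
      exact_mod_cast hle
    · have h := hrounds n ε hr
      have h' : ((phaseOneRounds n + phaseTwoRounds n ε : ℕ) : ℝ) = n + rExp n ε + 3 := by
        exact_mod_cast h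
      rw [h']
      exact hM n ε hn hr hMn
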